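/- Let $Q$ be a quiver with finitely many nodes and no oriented cycles, possibly with relations (complex linear combinations of parallel paths of positive length). Let $\mathbf{D}(Q)$ be the bounded derived category of finite-dimensional complex representations of $Q$ obeying the relations, and identify its Grothendieck group $K_0(Q)$ with the lattice of dimension vectors, the class of a complex being the alternating sum of the dimension vectors of its cohomology. For a node $j$ let $L_j$ be the one-dimensional representation supported at $j$; a representation is regarded as a complex in position zero. A $\Pi$-stability condition on $\mathbf{D}(Q)$ consists of a homomorphism $Z:K_0(Q)\to\mathbb{C}$, an isomorphism-invariant and shift-invariant class of nonzero objects, called stable, and a grade $\xi(A)\in\mathbb{R}$ for every stable $A$, such that: $\xi(A[n])=\xi(A)+n$; $Z(A)\in\mathbb{R}_{>0}\,e^{i\pi\xi(A)}$ for stable $A$; $\operatorname{Hom}(A,B)=0$ if $A,B$ are stable and $\xi(A)>\xi(B)$; every nonzero object $C$ that is not stable has a decay chain, that is, distinguished triangles $C_{k-1}\to C_k\to A_k\to C_{k-1}[1]$ $(1\le k\le m-1)$ with $C_0=A_0$, $C_{m-1}=C$, all $A_k$ stable and $\xi(A_0)\ge\xi(A_1)\ge\dots\ge\xi(A_{m-1})$;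 and a stable object has no decay chain with $m>1$. Theorem. Suppose that all $L_j$ are stable and that, for some $\psi\in\mathbb{R}$, $\psi<\xi(L_j)<\psi+1$ for all $j$. Then: 1. every $\Pi$-stable object of $\mathbf{D}(Q)$ is isomorphic to a stalk complex $V[n]$, for some representation $V$ and some $n\in\mathbb{Z}$; 2. $Z(V)\neq0$ for every nonzero representation $V$, so that $\theta(U)=-\operatorname{Im}\bigl(Z(U)/Z(V)\bigr)$ is defined; 3. for every representation $V$ and every $n\in\mathbb{Z}$, the object $V[n]$ is $\Pi$-stable if and only if $V$ is $\theta$-stable in the sense of King, that is, $V\neq0$, $\theta(V)=0$ (which holds automatically) and $\theta(U)>0$ for every subrepresentation $U\subset V$ with $U\ne0$ and $U\neq V$. -/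

import Mathlib

open CategoryTheory Limits Pretriangulated

universe w v u

noncomputable section

namespace PiTheta

/-! ### Quivers with relations and their representations -/

/-- A quiver is directed if it has no oriented cycles: every path from a node to itself is the
path of length zero. -/
def Directed (Q : Type u) [Quiver.{v} Q] : Prop :=
  ∀ (i : Q) (p : Quiver.Path i i), p.length = 0

/-- Relations on a quiver: a set of complex linear combinations of parallel paths, all of these
paths having positive length. -/
structure Relations (Q : Type u) [Quiver.{v} Q] where
  /-- the relations between the paths from `i` to `j` -/
  rel (i j : Q) : Set (Quiver.Path i j →₀ ℂ)
  /-- no relation involves a path of length zero -/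
  length_pos : ∀ {i j : Q} {r : Quiver.Path i j →₀ ℂ}, r ∈ rel i j →
    ∀ p ∈ r.support, 0 < p.length

variable {Q : Type u} [Quiver.{v} Q]

/-- The linear map that a path from `i` to `j` induces in a representation (without relations) of
the quiver. -/
def evalPath (V : Paths Q ⥤ FGModuleCat.{0} ℂ) {i j : Q} (p : Quiver.Path i j) :
    V.obj ((Paths.of Q).obj i) ⟶ V.obj ((Paths.of Q).obj j) :=
  V.map p

/-- The linear map that a linear combination of paths from `i` to `j` induces in a
representation (without relations) of the quiver. -/
def evalPaths (V : Paths Q ⥤ FGModuleCat.{0} ℂ) {i j : Q} (r : Quiver.Path i j →₀ ℂ) :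
    V.obj ((Paths.of Q).obj i) ⟶ V.obj ((Paths.of Q).obj j) :=
  r.sum fun p c => c • evalPath V p

/-- The representations that obey the relations. -/
def Satisfies (R : Relations Q) : ObjectProperty (Paths Q ⥤ FGModuleCat.{0} ℂ) := fun V =>
  ∀ (i j : Q), ∀ r ∈ R.rel i j, evalPaths V r = 0

/-- The category of finite-dimensional complex representations of a quiver with relations. -/
abbrev QRep (R : Relations Q) := (Satisfies R).FullSubcategory

theorem evalPath_naturality {V W : Paths Q ⥤ FGModuleCat.{0} ℂ} (f : V ⟶ W) {i j : Q}
    (p : Quiver.Path i j) :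
    evalPath V p ≫ f.app _ = f.app _ ≫ evalPath W p :=
  f.naturality _

theorem evalPaths_naturality {V W : Paths Q ⥤ FGModuleCat.{0} ℂ} (f : V ⟶ W) {i j : Q}
    (r : Quiver.Path i j →₀ ℂ) :
    evalPaths V r ≫ f.app _ = f.app _ ≫ evalPaths W r := by
  simp [evalPaths, Finsupp.sum, Preadditive.sum_comp, Preadditive.comp_sum, evalPath_naturality]

instance (R : Relations Q) : (Satisfies R).IsClosedUnderSubobjects where
  prop_of_mono {X Y} f _ hY i j r hr := by
    rw [← cancel_mono (f.app _), evalPaths_naturality, hY i j r hr]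
    simp

instance (R : Relations Q) : (Satisfies R).IsClosedUnderQuotients where
  prop_of_epi {X Y} f _ hX i j r hr := by
    rw [← cancel_epi (f.app _), ← evalPaths_naturality, hX i j r hr]
    simp

instance (R : Relations Q) : (Satisfies R).ContainsZero where
  exists_zero := by
    obtain ⟨Z, hZ⟩ := HasZeroObject.zero (C := Paths Q ⥤ FGModuleCat.{0} ℂ)
    exact ⟨Z, hZ, fun i j r _ => (hZ.obj _).eq_of_src _ _⟩

instance (R : Relations Q) : (Satisfies R).IsClosedUnderFiniteProducts where
  isClosedUnderLimitsOfShape J _ := by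
    refine ⟨?_⟩
    rintro X ⟨p⟩
    intro i j r hr
    refine (isLimitOfPreserves ((evaluation _ _).obj ((Paths.of Q).obj j)) p.isLimit).hom_ext ?_
    intro k
    have h := evalPaths_naturality (p.π.app k) r
    rw [p.prop_diag_obj k i j r hr, comp_zero] at h
    exact h.trans zero_comp.symm

/-- The dimension vector of a representation. -/
def dimVec {R : Relations Q} (V : QRep R) : Q → ℤ := fun j =>
  (Module.finrank ℂ (V.obj.obj ((Paths.of Q).obj j)) : ℤ)

/-- The representation `L_j` without its relations: `ℂ` at the node `j`, zero at all other nodes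
(functions on the truth value of `i = j`), and all arrows act as zero. -/
def simpleFunctor (j : Q) : Paths Q ⥤ FGModuleCat.{0} ℂ :=
  Paths.lift
    { obj := fun i => FGModuleCat.of ℂ (PLift (i = j) → ℂ)
      map := fun _ => 0 }

theorem evalPath_simpleFunctor (j : Q) {a b : Q} (p : Quiver.Path a b) (hp : 0 < p.length) :
    evalPath (simpleFunctor j) p = 0 := by
  cases p with
  | nil => simp at hp
  | cons p e => exact comp_zero

/-- The one-dimensional representation `L_j` supported at the node `j`. -/
def simpleRep (R : Relations Q) (j : Q) : QRep R :=
  ⟨simpleFunctor j, fun a b r hr => Finset.sum_eq_zero fun p hp => by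
    dsimp only
    rw [evalPath_simpleFunctor j p (R.length_pos hr p hp), smul_zero]⟩

/-! ### `θ`-stability -/

/-- The homomorphism `θ(U) = - Im (Z(U) / Z(V))` on dimension vectors. -/
def theta {R : Relations Q} (Z : (Q → ℤ) →+ ℂ) (V : QRep R) : (Q → ℤ) →+ ℝ where
  toFun d := -(Z d / Z (dimVec V)).im
  map_zero' := by simp
  map_add' d e := by simp only [map_add, add_div, Complex.add_im]; ring

/-- King's `θ`-stability of a representation `V`: it is nonzero, `θ(V) = 0`, and `θ(U) > 0` for
every subrepresentation `U` of `V` other than `0` and `V`. -/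
def IsThetaStable {R : Relations Q} (θ : (Q → ℤ) →+ ℝ) (V : QRep R) : Prop :=
  ¬ IsZero V ∧ θ (dimVec V) = 0 ∧
    ∀ (U : QRep R) (f : U ⟶ V), Mono f → ¬ IsZero U → ¬ IsIso f → 0 < θ (dimVec U)

/-! ### The bounded derived category `D(Q)` -/

variable (R : Relations Q) [HasDerivedCategory.{w} (QRep R)]

/-- The bounded derived category of finite-dimensional representations: the full triangulated
subcategory of the derived category on the objects with bounded cohomology. -/
abbrev DQ := (DerivedCategory.TStructure.t (C := QRep R)).bounded.FullSubcategory

variable {R}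

/-- A representation as a stalk complex in position zero. -/
def stalk (V : QRep R) : DQ R :=
  ⟨(DerivedCategory.singleFunctor (QRep R) 0).obj V,
    ⟨⟨0, inferInstance⟩, ⟨0, inferInstance⟩⟩⟩

/-- The class of a complex in the Grothendieck group, identified with the lattice of dimension
vectors: the alternating sum of the dimension vectors of its cohomology. -/
def classVec (X : DQ R) : Q → ℤ := fun j =>
  ∑ᶠ i : ℤ, (i.negOnePow : ℤ) *
    dimVec ((DerivedCategory.homologyFunctor (QRep R) i).obj X.obj) j

/-! ### `Π`-stability -/

section Stability

variable {T : Type*} [Category* T] [HasZeroObject T] [HasShift T ℤ] [Preadditive T]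
  [∀ n : ℤ, (shiftFunctor T n).Additive] [Pretriangulated T]

/-- A decay chain of `X` with the `n + 1` pieces `A 0, …, A n`: distinguished triangles
`C i ⟶ C (i + 1) ⟶ A (i + 1) ⟶ (C i)[1]` with `C 0 = A 0` and `C n = X`, in which the pieces are
stable and of non-increasing grade. -/
structure DecayChain (stable : ObjectProperty T) (ξ : T → ℝ) (X : T) (n : ℕ) where
  /-- the pieces -/
  A : Fin (n + 1) → T
  /-- the partial extensions -/
  C : Fin (n + 1) → T
  /-- the chain starts with the first piece -/
  init : C 0 ≅ A 0
  /-- the chain ends with `X` -/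
  last : C (Fin.last n) ≅ X
  /-- first maps of the triangles -/
  incl (i : Fin n) : C i.castSucc ⟶ C i.succ
  /-- second maps of the triangles -/
  proj (i : Fin n) : C i.succ ⟶ A i.succ
  /-- connecting maps of the triangles -/
  conn (i : Fin n) : A i.succ ⟶ (C i.castSucc)⟦(1 : ℤ)⟧
  distinguished (i : Fin n) : Triangle.mk (incl i) (proj i) (conn i) ∈ distTriang T
  stable_piece (i : Fin (n + 1)) : stable (A i)
  grade_antitone : Antitone fun i => ξ (A i)

/-- A `Π`-stability condition on a triangulated category `T` whose objects `X` have classes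
`cl X` in a lattice `Λ`: a central charge `Z`, the stable objects, and their grades `ξ`.  Only
the grades of stable objects are meaningful.  An unstable object is a nonzero object that is not
stable. -/
structure PiStability {Λ : Type*} [AddCommGroup Λ] (cl : T → Λ) where
  /-- the central charge -/
  Z : Λ →+ ℂ
  /-- the class of stable objects -/
  stable : ObjectProperty T
  /-- the grade of a stable object -/
  ξ : T → ℝ
  /-- stability depends only on the isomorphism class -/
  stable_of_iso : ∀ {A B : T}, (A ≅ B) → stable A → stable B
  /-- stable objects are nonzero -/
  not_isZero : ∀ {A : T}, stable A → ¬ IsZero A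
  /-- translates of stable objects are stable -/
  stable_shift : ∀ {A : T} (n : ℤ), stable A → stable (A⟦n⟧)
  /-- the grade of a translate -/
  ξ_shift : ∀ {A : T} (n : ℤ), stable A → ξ (A⟦n⟧) = ξ A + n
  /-- the unitarity constraint -/
  unitarity : ∀ {A B : T}, stable A → stable B → ξ B < ξ A → ∀ f : A ⟶ B, f = 0
  /-- every unstable object has a decay chain -/
  exists_decayChain : ∀ {X : T}, ¬ IsZero X → ¬ stable X →
    ∃ n : ℕ, Nonempty (DecayChain stable ξ X n)
  /-- a stable object has no decay chain with more than one piece -/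
  no_decayChain : ∀ {X : T}, stable X → ∀ n : ℕ, 0 < n → IsEmpty (DecayChain stable ξ X n)
  /-- the grade of a stable object is `1 / π` times an argument of its central charge -/
  charge_eq : ∀ {A : T}, stable A →
    ∃ m : ℝ, 0 < m ∧ Z (cl A) = m * Complex.exp (Real.pi * ξ A * Complex.I)

end Stability

end PiTheta

end

/-!
The theorem compares two hearts of `D(Q)`: the representations, and the objects built from stable
objects with grades in an interval of length one above `ψ`. They coincide because the simple
representations `L_j` lie in both and generate the representations by extensions.

*Stable objects are stalk complexes.* Let `X` be stable with `ψ < ξ(X) ≤ ψ + 1`. As `ψ < ξ(L_j) <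
ψ + 1`, the condition on grades gives `Hom(L_j[n], X) = 0` and `Hom(X, L_j[-n]) = 0` for `n > 0`.
Every representation is an iterated extension of the `L_j` (`exists_mono_simpleRep`), so the `L_j`
may be replaced by arbitrary representations, and truncation for the standard t-structure shows
that `X` has cohomology in degree zero only (`Comparison.exists_iso_of_stable`). Every stable
object has a translate with grade in `(ψ, ψ + 1]`.

*The charge.* The class of a representation is the sum of the classes of its composition factors
`L_j`, and the numbers `Z(L_j)`, turned by the angle `-πψ`, lie in the open upper half plane. So
does `Z(V)` for every nonzero `V`. Minus the cotangent of the argument of the turned charge is a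
quotient of additive functions, a slope; `θ`-stability is slope stability (`isThetaStable_iff`),
and grades of stable representations are ordered as their slopes (`Comparison.slope_lt_iff`).

*Slope stable implies `Π`-stable* (`Comparison.stable_of_slope_stable`). Suppose that `V` has a
decay chain with more than one piece. The first piece has a nonzero map to `V`, as no step of the
chain can kill one, and `V` has a nonzero map to the last piece, which would otherwise be a direct
summand of an object built from pieces of greater grade. Hence all grades lie between `ψ` and `ψ + 1`, the chain consists of representations, and
its last triangle is a short exact sequence `U ⟶ V ⟶ W` in which the slope of `U` is at least that
of `W`, although the slope stability of `V` requires it to be smaller.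

*`Π`-stable implies slope stable* (`Comparison.slope_stable_of_stable`). If a subobject of `V` had
a greater slope, the quotient would have a slope stable quotient `B` of slope less than that of
`V`; but `B` is `Π`-stable, of smaller grade than `V`, and receives a nonzero map from `V`. So `V`
is semistable, and a Jordan–Hölder filtration with slope stable factors of equal slope is a decay
chain of `V`. It can only have one piece.
-/

noncomputable section

namespace PiTheta

open Triangulated
open scoped ZeroObject

/-! ### Representations: dimension vectors and the subrepresentations `L_j` -/

variable {Q : Type u} [Quiver.{v} Q] {R : Relations Q}

/-- The functor that sends a representation to its vector space at the node `j`. -/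
def nodeFunctor (R : Relations Q) (j : Q) : QRep R ⥤ ModuleCat.{0} ℂ :=
  (Satisfies R).ι ⋙ (evaluation _ _).obj ((Paths.of Q).obj j) ⋙
    forget₂ (FGModuleCat ℂ) (ModuleCat ℂ)

instance (R : Relations Q) : PreservesFiniteLimits (Satisfies R).ι := by
  have := fun (X Y : QRep R) (f : X ⟶ Y) => (Satisfies R).preservesKernels_ι f
  exact (Satisfies R).ι.preservesFiniteLimits_of_preservesKernels

instance (R : Relations Q) : PreservesFiniteColimits (Satisfies R).ι := by
  have := fun (X Y : QRep R) (f : X ⟶ Y) => (Satisfies R).preservesCokernels_ι f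
  exact (Satisfies R).ι.preservesFiniteColimits_of_preservesCokernels

instance (R : Relations Q) (j : Q) : PreservesFiniteLimits (nodeFunctor R j) := by
  unfold nodeFunctor; infer_instance

instance (R : Relations Q) (j : Q) : PreservesFiniteColimits (nodeFunctor R j) := by
  unfold nodeFunctor; infer_instance

instance (R : Relations Q) (j : Q) : (nodeFunctor R j).PreservesZeroMorphisms := by
  unfold nodeFunctor; infer_instance

theorem dimVec_eq_finrank (V : QRep R) (j : Q) :
    dimVec V j = (Module.finrank ℂ ((nodeFunctor R j).obj V) : ℤ) := rfl

instance (V : QRep R) (j : Q) : Module.Finite ℂ ((nodeFunctor R j).obj V) :=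
  inferInstanceAs (Module.Finite ℂ (V.obj.obj ((Paths.of Q).obj j)))

theorem dimVec_shortExact {S : ShortComplex (QRep R)} (hS : S.ShortExact) :
    dimVec S.X₂ = dimVec S.X₁ + dimVec S.X₃ := by
  funext j
  have h := (hS.map_of_exact (nodeFunctor R j))
  have : Module.Finite ℂ (S.map (nodeFunctor R j)).X₁ :=
    inferInstanceAs (Module.Finite ℂ ((nodeFunctor R j).obj S.X₁))
  have : Module.Finite ℂ (S.map (nodeFunctor R j)).X₃ :=
    inferInstanceAs (Module.Finite ℂ ((nodeFunctor R j).obj S.X₃))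
  replace h := ModuleCat.free_shortExact_finrank_add h rfl rfl
  simp only [Pi.add_apply, dimVec_eq_finrank]
  exact_mod_cast h

theorem isZero_iff_dimVec_eq_zero (V : QRep R) : IsZero V ↔ dimVec V = 0 := by
  constructor
  · intro h
    funext j
    have : Subsingleton ((nodeFunctor R j).obj V) :=
      ModuleCat.subsingleton_of_isZero ((nodeFunctor R j).map_isZero h)
    simp [dimVec_eq_finrank, Module.finrank_zero_of_subsingleton]
  · intro h
    refine IsZero.of_full_of_faithful_of_isZero (Satisfies R).ι V (Functor.isZero _ fun j => ?_)
    refine IsZero.of_full_of_faithful_of_isZero (forget₂ (FGModuleCat ℂ) (ModuleCat ℂ)) _ ?_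
    have h0 : dimVec V ((show Q from j) : Q) = 0 := congr_fun h j
    rw [dimVec_eq_finrank, Nat.cast_eq_zero, Module.finrank_zero_iff] at h0
    exact ModuleCat.isZero_of_subsingleton ((nodeFunctor R j).obj V)

theorem dimVec_simpleRep [DecidableEq Q] (j : Q) : dimVec (simpleRep R j) = Pi.single j 1 := by
  funext i
  change (Module.finrank ℂ (PLift (i = j) → ℂ) : ℤ) = _
  classical
  rw [Module.finrank_fintype_fun_eq_card, Pi.single_apply]
  split_ifs with h
  · have : Unique (PLift (i = j)) := ⟨⟨⟨h⟩⟩, fun _ => rfl⟩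
    simp
  · have : IsEmpty (PLift (i = j)) := ⟨fun x => h x.down⟩
    simp

theorem dimVec_eq_sum_simpleRep [Fintype Q] (V : QRep R) :
    dimVec V = ∑ j, dimVec V j • dimVec (simpleRep R j) := by
  classical
  funext i
  simp [dimVec_simpleRep, Finset.sum_apply, Pi.single_apply]

theorem dimVec_nonneg (V : QRep R) (j : Q) : 0 ≤ dimVec V j := Int.natCast_nonneg _

/-- The component at the node `i` of the map `L_j ⟶ V` given by a vector of `V` at `j`. -/
def simpleToRepApp {V : QRep R} {j : Q} (x : V.obj.obj ((Paths.of Q).obj j)) (i : Q) :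
    (PLift (i = j) → ℂ) →ₗ[ℂ] V.obj.obj ((Paths.of Q).obj i) :=
  letI := Fintype.ofFinite (PLift (i = j))
  Fintype.linearCombination ℂ fun h : PLift (i = j) =>
    (h.down.symm.rec x : V.obj.obj ((Paths.of Q).obj i))

theorem simpleToRepApp_self {V : QRep R} {j : Q} (x : V.obj.obj ((Paths.of Q).obj j))
    (g : PLift (j = j) → ℂ) : simpleToRepApp x j g = g ⟨rfl⟩ • x := by
  let _ := Fintype.ofFinite (PLift (j = j))
  have : Unique (PLift (j = j)) := ⟨⟨⟨rfl⟩⟩, fun _ => rfl⟩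
  rw [simpleToRepApp, Fintype.linearCombination_apply, Fintype.sum_unique]

theorem simpleToRepApp_of_ne {V : QRep R} {j : Q} (x : V.obj.obj ((Paths.of Q).obj j))
    {i : Q} (h : i ≠ j) (g : PLift (i = j) → ℂ) : simpleToRepApp x i g = 0 := by
  have : IsEmpty (PLift (i = j)) := ⟨fun y => h y.down⟩
  let _ := Fintype.ofFinite (PLift (i = j))
  rw [simpleToRepApp, Fintype.linearCombination_apply, Fintype.sum_empty]

theorem map_simpleToRepApp {V : QRep R} {j : Q} (x : V.obj.obj ((Paths.of Q).obj j))
    (hx : ∀ (k : Q) (e : j ⟶ k), (V.obj.map ((Paths.of Q).map e)).hom.hom x = 0)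
    {a b : Q} (e : a ⟶ b) (g : PLift (a = j) → ℂ) :
    (V.obj.map ((Paths.of Q).map e)).hom.hom (simpleToRepApp x a g) = 0 := by
  by_cases h : a = j
  · subst h
    rw [simpleToRepApp_self, map_smul, hx, smul_zero]
  · rw [simpleToRepApp_of_ne x h, map_zero]

/-- A transformation between functors on a path category is natural if it is so for arrows. -/
def natTransOfArrows {C : Type*} [Category* C] {F G : Paths Q ⥤ C} (φ : ∀ i, F.obj i ⟶ G.obj i)
    (h : ∀ {a b : Q} (e : a ⟶ b), F.map ((Paths.of Q).map e) ≫ φ ((Paths.of Q).obj b) =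
      φ ((Paths.of Q).obj a) ≫ G.map ((Paths.of Q).map e)) : F ⟶ G where
  app := φ
  naturality a b p := by
    refine Paths.induction_fixed_source (a := a)
      (fun {b} p => F.map p ≫ φ b = φ a ≫ G.map p) (by simp) (fun {b c} p e ih => ?_) p
    rw [F.map_comp, Category.assoc, h, ← Category.assoc, ih, Category.assoc, G.map_comp]

/-- A vector at the node `j` that is killed by all arrows spans a copy of `L_j`. -/
def simpleToRep {V : QRep R} {j : Q} (x : V.obj.obj ((Paths.of Q).obj j))
    (hx : ∀ (k : Q) (e : j ⟶ k), (V.obj.map ((Paths.of Q).map e)).hom.hom x = 0) :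
    simpleRep R j ⟶ V :=
  ObjectProperty.homMk <| natTransOfArrows (F := simpleFunctor j) (G := V.obj)
    (fun i => FGModuleCat.ofHom (simpleToRepApp x i)) fun {a b} e => by
      have h1 : (simpleFunctor j).map ((Paths.of Q).map e) = 0 := comp_zero
      rw [h1]
      refine zero_comp.trans ?_
      refine FGModuleCat.hom_ext (LinearMap.ext fun g => ?_)
      exact (map_simpleToRepApp x hx e g).symm

theorem mono_simpleToRep {V : QRep R} {j : Q} {x : V.obj.obj ((Paths.of Q).obj j)}
    (hx : ∀ (k : Q) (e : j ⟶ k), (V.obj.map ((Paths.of Q).map e)).hom.hom x = 0) (h0 : x ≠ 0) :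
    Mono (simpleToRep x hx) := by
  apply (Satisfies R).ι.mono_of_mono_map
  rw [NatTrans.mono_iff_mono_app]
  intro i
  apply (forget₂ (FGModuleCat ℂ) (ModuleCat ℂ)).mono_of_mono_map
  rw [ModuleCat.mono_iff_injective]
  change Function.Injective (simpleToRepApp x i)
  by_cases h : (show Q from i) = j
  · obtain rfl := h
    intro f g hfg
    rw [simpleToRepApp_self, simpleToRepApp_self] at hfg
    funext y
    exact smul_left_injective ℂ h0 hfg
  · have : IsEmpty (PLift ((show Q from i) = j)) := ⟨fun y => h y.down⟩
    exact Function.injective_of_subsingleton (α := PLift ((show Q from i) = j) → ℂ) _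

/-- In a directed quiver with finitely many nodes, every nonzero representation has a
subrepresentation `L_j`: take a vector at a node of the support from which no arrow leads to
another node of the support. -/
theorem exists_mono_simpleRep [Finite Q] (hQ : Directed Q) (V : QRep R) (hV : ¬ IsZero V) :
    ∃ (j : Q) (f : simpleRep R j ⟶ V), Mono f := by
  -- `r a b`: some path of positive length leads from `b` to `a`, so minimal nodes are sinks
  let r : Q → Q → Prop := fun a b => ∃ p : Quiver.Path b a, 0 < p.length
  have : IsTrans Q r := ⟨fun a b c ⟨p, hp⟩ ⟨q, hq⟩ =>
    ⟨q.comp p, by rw [Quiver.Path.length_comp]; omega⟩⟩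
  have : Std.Irrefl r := ⟨fun a ⟨p, hp⟩ => by have := hQ a p; omega⟩
  have wf : WellFounded r := Finite.wellFounded_of_trans_of_irrefl r
  obtain ⟨j, hj, hmin⟩ := wf.has_min {j | dimVec V j ≠ 0}
    (Function.ne_iff.1 (mt (isZero_iff_dimVec_eq_zero V).2 hV))
  have hne : Nontrivial (V.obj.obj ((Paths.of Q).obj j)) := by
    by_contra h
    rw [not_nontrivial_iff_subsingleton] at h
    exact hj (by simp [dimVec, Module.finrank_zero_of_subsingleton])
  obtain ⟨x, hx⟩ := exists_ne (0 : V.obj.obj ((Paths.of Q).obj j))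
  refine ⟨j, simpleToRep x fun k e => ?_, mono_simpleToRep _ hx⟩
  have hk : dimVec V k = 0 := by
    by_contra h
    exact hmin k h ⟨e.toPath, by simp⟩
  rw [dimVec, Nat.cast_eq_zero, Module.finrank_zero_iff] at hk
  exact Subsingleton.elim _ _

/-! ### Distinguished triangles, hearts and decay chains -/

theorem hom_shift_eq_zero {T : Type*} [Category* T] [HasShift T ℤ] [Preadditive T]
    [∀ n : ℤ, (shiftFunctor T n).Additive] {X Y : T} (n : ℤ) (h0 : ∀ l : X ⟶ Y⟦-n⟧, l = 0)
    (k : X⟦n⟧ ⟶ Y) : k = 0 := by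
  let e : X ≅ X⟦n⟧⟦-n⟧ := (shiftEquiv T n).unitIso.app X
  apply (shiftFunctor T (-n)).map_injective
  rw [← cancel_epi e.hom, Functor.map_zero, comp_zero]
  exact h0 _

section Triangles

variable {T : Type*} [Category* T] [HasZeroObject T] [HasShift T ℤ] [Preadditive T]
  [∀ n : ℤ, (shiftFunctor T n).Additive] [Pretriangulated T]
  {X Y Z W : T} {f : X ⟶ Y} {g : Y ⟶ Z} {h : Z ⟶ X⟦(1 : ℤ)⟧}

theorem exists_lift_of_distTriang (hT : Triangle.mk f g h ∈ distTriang T) (k : W ⟶ Y)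
    (hk : k ≫ g = 0) : ∃ l : W ⟶ X, k = l ≫ f :=
  Triangle.coyoneda_exact₂ _ hT k hk

theorem exists_desc_of_distTriang (hT : Triangle.mk f g h ∈ distTriang T) (k : Y ⟶ W)
    (hk : f ≫ k = 0) : ∃ l : Z ⟶ W, k = g ≫ l :=
  Triangle.yoneda_exact₂ _ hT k hk

theorem eq_zero_of_comp_left_eq_zero (hT : Triangle.mk f g h ∈ distTriang T) (k : W ⟶ X)
    (hk : k ≫ f = 0) (h0 : ∀ l : W ⟶ Z⟦(-1 : ℤ)⟧, l = 0) : k = 0 := by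
  obtain ⟨l, hl⟩ := exists_lift_of_distTriang (inv_rot_of_distTriang _ hT) k hk
  exact hl.trans ((congrArg (· ≫ _) (h0 l)).trans zero_comp)

theorem eq_zero_of_comp_right_eq_zero (hT : Triangle.mk f g h ∈ distTriang T) (k : Z ⟶ W)
    (hk : g ≫ k = 0) (h0 : ∀ l : X⟦(1 : ℤ)⟧ ⟶ W, l = 0) : k = 0 := by
  obtain ⟨l, hl⟩ := exists_desc_of_distTriang (rot_of_distTriang _ hT) k hk
  exact hl.trans ((congrArg (_ ≫ ·) (h0 l)).trans comp_zero)

theorem distTriang_of_iso (hT : Triangle.mk f g h ∈ distTriang T) {X' Y' Z' : T}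
    (eX : X' ≅ X) (eY : Y' ≅ Y) (eZ : Z' ≅ Z) :
    Triangle.mk (eX.hom ≫ f ≫ eY.inv) (eY.hom ≫ g ≫ eZ.inv) (eZ.hom ≫ h ≫ eX.inv⟦(1 : ℤ)⟧') ∈
      distTriang T := by
  refine isomorphic_distinguished _ hT _ (Triangle.isoMk _ _ eX eY eZ ?_ ?_ ?_)
  · exact (by simp : (eX.hom ≫ f ≫ eY.inv) ≫ eY.hom = eX.hom ≫ f)
  · exact (by simp : (eY.hom ≫ g ≫ eZ.inv) ≫ eZ.hom = eY.hom ≫ g)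
  · exact (by simp [← Functor.map_comp] :
      (eZ.hom ≫ h ≫ eX.inv⟦(1 : ℤ)⟧') ≫ eX.hom⟦(1 : ℤ)⟧' = eZ.hom ≫ h)

end Triangles

section TStructure

variable {T : Type*} [Category* T] [HasZeroObject T] [HasShift T ℤ] [Preadditive T]
  [∀ n : ℤ, (shiftFunctor T n).Additive] [Pretriangulated T]
  (t : TStructure T)

variable {A : Type*} [Category* A] [Abelian A] [t.Heart A]

theorem exists_iso_heart (X : T) [t.IsLE X 0] [t.IsGE X 0] :
    ∃ V : A, Nonempty (X ≅ t.ιHeart.obj V) := by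
  have h : (t.ιHeart (H := A)).essImage X := by
    rw [t.essImage_ιHeart, t.mem_heart_iff]
    exact ⟨inferInstance, inferInstance⟩
  exact ⟨h.witness, ⟨h.getIso.symm⟩⟩

variable (A) in
/-- An object in degrees `≥ 0` that receives no nonzero map from the heart lies in degrees `≥ 1`:
its truncation `τ≤0` lies in the heart and maps to it by zero. -/
theorem isGE_one_of_heart [IsTriangulated T] (X : T) [t.IsGE X 0]
    (hX : ∀ (V : A) (f : t.ιHeart.obj V ⟶ X), f = 0) : t.IsGE X 1 := by
  rw [t.isGE_iff_isZero_truncLE_obj 0 1 rfl, IsZero.iff_id_eq_zero]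
  obtain ⟨V, ⟨e⟩⟩ := exists_iso_heart t (A := A) ((t.truncLE 0).obj X)
  apply t.to_truncLE_obj_ext
  have : (t.truncLEι 0).app X = 0 := by
    rw [← cancel_epi e.inv, comp_zero]
    exact hX _ _
  rw [this, comp_zero, comp_zero]

variable (A) in
/-- An object in degrees `≤ 0` with no nonzero map to the heart lies in degrees `≤ -1`: its
truncation `τ≥0` lies in the heart and receives the zero map from it. -/
theorem isLE_neg_one_of_heart [IsTriangulated T] (X : T) [t.IsLE X 0]
    (hX : ∀ (V : A) (f : X ⟶ t.ιHeart.obj V), f = 0) : t.IsLE X (-1) := by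
  rw [t.isLE_iff_isZero_truncGE_obj (-1) 0 rfl, IsZero.iff_id_eq_zero]
  obtain ⟨V, ⟨e⟩⟩ := exists_iso_heart t (A := A) ((t.truncGE 0).obj X)
  apply t.from_truncGE_obj_ext
  have : (t.truncGEπ 0).app X = 0 := by
    rw [← cancel_mono e.hom, zero_comp]
    exact hX _ _
  rw [this, zero_comp, zero_comp]

theorem ιHeart_hom_shift_eq_zero ⦃V W : A⦄ ⦃n : ℤ⦄
    (f : t.ιHeart.obj V ⟶ (t.ιHeart.obj W)⟦n⟧) (hn : n < 0) : f = 0 := by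
  have := t.isGE_shift (t.ιHeart.obj W) 0 n (-n)
  exact t.zero f 0 (-n)

/-- A distinguished triangle whose outer terms lie in the heart is a short exact sequence of the
heart. -/
theorem exists_shortExact_of_distTriang {X Y Z : T} {f : X ⟶ Y} {g : Y ⟶ Z}
    {h : Z ⟶ X⟦(1 : ℤ)⟧} (hT : Triangle.mk f g h ∈ distTriang T) {U W : A}
    (eX : X ≅ t.ιHeart.obj U) (eZ : Z ≅ t.ιHeart.obj W) :
    ∃ (V : A) (i : U ⟶ V) (p : V ⟶ W) (w : i ≫ p = 0),
      (ShortComplex.mk i p w).ShortExact ∧ Nonempty (Y ≅ t.ιHeart.obj V) := by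
  have := t.isLE_of_iso eX.symm 0
  have := t.isLE_of_iso eZ.symm 0
  have := t.isGE_of_iso eX.symm 0
  have := t.isGE_of_iso eZ.symm 0
  have : t.IsLE Y 0 := t.isLE₂ _ hT 0 ‹_› ‹_›
  have : t.IsGE Y 0 := t.isGE₂ _ hT 0 ‹_› ‹_›
  obtain ⟨V, ⟨e⟩⟩ := exists_iso_heart t (A := A) Y
  obtain ⟨i, hi⟩ := t.ιHeart.map_surjective (eX.inv ≫ f ≫ e.hom)
  obtain ⟨p, hp⟩ := t.ιHeart.map_surjective (e.inv ≫ g ≫ eZ.hom)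
  have hT' := distTriang_of_iso hT eX.symm e.symm eZ.symm
  dsimp only [Iso.symm_hom, Iso.symm_inv] at hT'
  rw [← hi, ← hp] at hT'
  have k := AbelianSubcategory.isLimitKernelForkOfDistTriang (ιHeart_hom_shift_eq_zero t) i p _ hT'
  have c := AbelianSubcategory.isColimitCokernelCoforkOfDistTriang
    (ιHeart_hom_shift_eq_zero t) i p _ hT'
  have w : i ≫ p = 0 := t.ιHeart.map_injective <|
    (t.ιHeart.map_comp i p).trans <| (comp_distTriang_mor_zero₁₂ _ hT').trans
      (t.ιHeart.map_zero U W).symm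
  have : Mono i := Fork.IsLimit.mono k
  have : Epi p := Cofork.IsColimit.epi c
  exact ⟨V, i, p, w, ⟨ShortComplex.exact_of_f_is_kernel _ k⟩, ⟨e⟩⟩

end TStructure

section DecayChain

variable {T : Type*} [Category* T] [HasZeroObject T] [HasShift T ℤ] [Preadditive T]
  [∀ n : ℤ, (shiftFunctor T n).Additive] [Pretriangulated T]

/-- A stable object is a decay chain with one piece. -/
def DecayChain.single {stable : ObjectProperty T} (ξ : T → ℝ) {X : T} (hX : stable X) :
    DecayChain stable ξ X 0 where
  A _ := X
  C _ := X
  init := Iso.refl X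
  last := Iso.refl X
  incl i := i.elim0
  proj i := i.elim0
  conn i := i.elim0
  distinguished i := i.elim0
  stable_piece _ := hX
  grade_antitone _ _ _ := le_rfl

/-- A decay chain of `X` extends to one of `Y` along a distinguished triangle `X ⟶ Y ⟶ B` with
`B` stable of grade at most that of the last piece. -/
theorem DecayChain.exists_snoc {stable : ObjectProperty T} {ξ : T → ℝ} {X Y B : T} {n : ℕ}
    (c : DecayChain stable ξ X n) {f : X ⟶ Y} {g : Y ⟶ B} {h : B ⟶ X⟦(1 : ℤ)⟧}
    (hT : Triangle.mk f g h ∈ distTriang T) (hB : stable B) (hξ : ξ B ≤ ξ (c.A (Fin.last n))) :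
    ∃ c' : DecayChain stable ξ Y (n + 1), ∀ i, c'.A i = (Fin.snoc c.A B : Fin (n + 2) → T) i := by
  let A' : Fin (n + 2) → T := Fin.snoc c.A B
  let C' : Fin (n + 2) → T := Fin.snoc c.C Y
  have hA (i : Fin (n + 1)) : A' i.castSucc = c.A i := Fin.snoc_castSucc ..
  have hA' : A' (Fin.last _) = B := Fin.snoc_last ..
  have hC (i : Fin (n + 1)) : C' i.castSucc = c.C i := Fin.snoc_castSucc ..
  have hC' : C' (Fin.last _) = Y := Fin.snoc_last ..
  have key : ∀ i : Fin (n + 1), ∃ (a : C' i.castSucc ⟶ C' i.succ) (b : C' i.succ ⟶ A' i.succ)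
      (d : A' i.succ ⟶ (C' i.castSucc)⟦(1 : ℤ)⟧), Triangle.mk a b d ∈ distTriang T := by
    intro i
    induction i using Fin.lastCases with
    | last =>
      rw [Fin.succ_last, hC, hC', hA']
      exact ⟨_, _, _, distTriang_of_iso hT c.last (Iso.refl _) (Iso.refl _)⟩
    | cast i =>
      rw [← Fin.castSucc_succ, hC, hC, hA]
      exact ⟨_, _, _, c.distinguished i⟩
  choose a b d habd using key
  refine ⟨⟨A', C', eqToIso (hC 0) ≪≫ c.init ≪≫ eqToIso (hA 0).symm, eqToIso hC', a, b, d, habd,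
    fun i => ?_, ?_⟩, fun i => rfl⟩
  · induction i using Fin.lastCases with
    | last => rw [hA']; exact hB
    | cast i => rw [hA]; exact c.stable_piece i
  · intro i j hij
    change ξ (A' j) ≤ ξ (A' i)
    induction j using Fin.lastCases with
    | last =>
      induction i using Fin.lastCases with
      | last => rfl
      | cast i => rw [hA', hA]; exact hξ.trans (c.grade_antitone i.le_last)
    | cast j =>
      induction i using Fin.lastCases with
      | last => exact absurd hij (by simp)
      | cast i => rw [hA, hA]; exact c.grade_antitone (by simpa using hij)

variable {Λ : Type*} [AddCommGroup Λ] {cl : T → Λ} (S : PiStability cl)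

theorem PiStability.id_ne_zero {X : T} (h : S.stable X) : 𝟙 X ≠ 0 := fun h0 =>
  S.not_isZero h ((IsZero.iff_id_eq_zero X).2 h0)

/-- Isomorphic stable objects have the same grade, since the isomorphisms are nonzero. -/
theorem PiStability.ξ_eq_of_iso {X Y : T} (e : X ≅ Y) (h : S.stable X) : S.ξ X = S.ξ Y := by
  have h' := S.stable_of_iso e h
  refine le_antisymm (not_lt.1 fun hlt => S.id_ne_zero h ?_)
    (not_lt.1 fun hlt => S.id_ne_zero h ?_)
  · rw [← e.hom_inv_id, S.unitarity h h' hlt e.hom, zero_comp]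
  · rw [← e.hom_inv_id, S.unitarity h' h hlt e.inv, comp_zero]

/-- The first piece of a decay chain has a nonzero map to the object: a map that dies in the
next step of the chain factors through a piece of smaller grade. -/
theorem PiStability.exists_first_ne_zero {X : T} {n : ℕ} (c : DecayChain S.stable S.ξ X n) :
    ∃ f : c.A 0 ⟶ X, f ≠ 0 := by
  have key : ∀ i, ∃ f : c.A 0 ⟶ c.C i, f ≠ 0 := by
    intro i
    induction i using Fin.induction with
    | zero =>
      refine ⟨c.init.inv, fun h => S.id_ne_zero (c.stable_piece 0) ?_⟩
      rw [← c.init.inv_hom_id, h, zero_comp]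
    | succ i ih =>
      obtain ⟨f, hf⟩ := ih
      refine ⟨f ≫ c.incl i, fun h => hf ?_⟩
      have hst := S.stable_shift (-1) (c.stable_piece i.succ)
      refine eq_zero_of_comp_left_eq_zero (c.distinguished i) f h
        (S.unitarity (c.stable_piece 0) hst ?_)
      rw [S.ξ_shift _ (c.stable_piece _)]
      have := c.grade_antitone (Fin.zero_le i.succ)
      dsimp only at this
      push_cast
      linarith
  obtain ⟨f, hf⟩ := key (Fin.last n)
  refine ⟨f ≫ c.last.hom, fun h => hf ?_⟩
  rw [← cancel_mono c.last.hom, h, zero_comp]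

/-- An object with a decay chain has a nonzero map to the last piece: otherwise the last piece
would be a direct summand of an object whose pieces have greater grade. -/
theorem PiStability.exists_last_ne_zero {X : T} {n : ℕ} (c : DecayChain S.stable S.ξ X n) :
    ∃ f : X ⟶ c.A (Fin.last n), f ≠ 0 := by
  suffices ∃ f : c.C (Fin.last n) ⟶ c.A (Fin.last n), f ≠ 0 by
    obtain ⟨f, hf⟩ := this
    refine ⟨c.last.inv ≫ f, fun h => hf ?_⟩
    rw [← cancel_epi c.last.inv, h, comp_zero]
  cases n with
  | zero =>
    refine ⟨c.init.hom, fun h => S.id_ne_zero (c.stable_piece 0) ?_⟩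
    rw [← c.init.inv_hom_id, h, comp_zero]
  | succ n =>
    have hB := c.stable_piece (Fin.last (n + 1))
    have key : ∀ (i : Fin (n + 2)) (f : c.C i ⟶ (c.A (Fin.last (n + 1)))⟦(-1 : ℤ)⟧), f = 0 := by
      intro i
      have h0 (j : Fin (n + 2)) (f : c.A j ⟶ (c.A (Fin.last (n + 1)))⟦(-1 : ℤ)⟧) : f = 0 :=
        S.unitarity (c.stable_piece j) (S.stable_shift _ hB) (by
          rw [S.ξ_shift _ hB]
          have := c.grade_antitone j.le_last
          dsimp only at this
          push_cast
          linarith) f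
      induction i using Fin.induction with
      | zero =>
        intro f
        rw [← cancel_epi c.init.inv, comp_zero]
        exact h0 _ _
      | succ i ih =>
        intro f
        obtain ⟨k, hk⟩ := exists_desc_of_distTriang (c.distinguished i) f (ih _)
        rw [hk, h0 _ k, comp_zero]
    refine ⟨c.proj (Fin.last n), fun h => S.id_ne_zero hB ?_⟩
    exact eq_zero_of_comp_right_eq_zero (c.distinguished (Fin.last n)) (𝟙 _)
      ((Category.comp_id _).trans h) (hom_shift_eq_zero 1 (key _))

end DecayChain

/-! ### Slope stability in abelian categories -/

section Slope

/-- A slope function on an abelian category: an additive degree and an additive rank, the rank of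
a nonzero object being positive, together with an additive length that allows induction. -/
structure SlopeFunction (A : Type*) [Category* A] [Abelian A] where
  /-- the degree -/
  deg : A → ℝ
  /-- the rank -/
  rank : A → ℝ
  /-- the length -/
  len : A → ℕ
  deg_add {S : ShortComplex A} : S.ShortExact → deg S.X₂ = deg S.X₁ + deg S.X₃
  rank_add {S : ShortComplex A} : S.ShortExact → rank S.X₂ = rank S.X₁ + rank S.X₃
  len_add {S : ShortComplex A} : S.ShortExact → len S.X₂ = len S.X₁ + len S.X₃
  rank_pos {V : A} : ¬ IsZero V → 0 < rank V
  len_pos {V : A} : ¬ IsZero V → 0 < len V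

variable {A : Type*} [Category* A] [Abelian A]

theorem shortExact_of_mono {U V : A} (f : U ⟶ V) [Mono f] :
    (ShortComplex.mk f (cokernel.π f) (cokernel.condition f)).ShortExact :=
  ⟨ShortComplex.exact_cokernel f⟩

theorem shortExact_of_epi {V W : A} (g : V ⟶ W) [Epi g] :
    (ShortComplex.mk (kernel.ι g) g (kernel.condition g)).ShortExact :=
  ⟨ShortComplex.exact_kernel g⟩

theorem not_isZero_cokernel {U V : A} (f : U ⟶ V) [Mono f] (hf : ¬ IsIso f) :
    ¬ IsZero (cokernel f) := fun h =>
  hf ((shortExact_of_mono f).isIso_f_iff.2 h)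

theorem not_isZero_kernel {V W : A} (g : V ⟶ W) [Epi g] (hg : ¬ IsIso g) :
    ¬ IsZero (kernel g) := fun h =>
  hg ((shortExact_of_epi g).isIso_g_iff.2 h)

namespace SlopeFunction

variable (σ : SlopeFunction A)

/-- The slope of an object, meaningful if the object is nonzero. -/
def slope (V : A) : ℝ := σ.deg V / σ.rank V

/-- Slope stability: every proper nonzero subobject has smaller slope. -/
def IsStable (V : A) : Prop :=
  ¬ IsZero V ∧ ∀ (U : A) (f : U ⟶ V), Mono f → ¬ IsZero U → ¬ IsIso f → σ.slope U < σ.slope V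

variable {σ} {S : ShortComplex A}

theorem slope_left_lt_iff (hS : S.ShortExact) (h₁ : ¬ IsZero S.X₁) (h₃ : ¬ IsZero S.X₃) :
    σ.slope S.X₁ < σ.slope S.X₂ ↔ σ.slope S.X₂ < σ.slope S.X₃ := by
  have p₁ := σ.rank_pos h₁
  have p₃ := σ.rank_pos h₃
  rw [slope, slope, slope, σ.deg_add hS, σ.rank_add hS, div_lt_div_iff₀ p₁ (by positivity),
    div_lt_div_iff₀ (by positivity) p₃]
  constructor <;> intro h <;> nlinarith

theorem slope_middle_lt_iff (hS : S.ShortExact) (h₁ : ¬ IsZero S.X₁) (h₃ : ¬ IsZero S.X₃) :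
    σ.slope S.X₂ < σ.slope S.X₁ ↔ σ.slope S.X₃ < σ.slope S.X₂ := by
  have p₁ := σ.rank_pos h₁
  have p₃ := σ.rank_pos h₃
  rw [slope, slope, slope, σ.deg_add hS, σ.rank_add hS, div_lt_div_iff₀ (by positivity) p₁,
    div_lt_div_iff₀ p₃ (by positivity)]
  constructor <;> intro h <;> nlinarith

theorem le_slope_middle (hS : S.ShortExact) (h₁ : ¬ IsZero S.X₁) (h₃ : ¬ IsZero S.X₃) {s : ℝ}
    (hs₁ : s ≤ σ.slope S.X₁) (hs₃ : s ≤ σ.slope S.X₃) : s ≤ σ.slope S.X₂ := by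
  by_contra! h
  have := (slope_middle_lt_iff (σ := σ) hS h₁ h₃).1 (by linarith)
  linarith

theorem slope_eq_of_iso {V W : A} (e : V ≅ W) : σ.slope V = σ.slope W := by
  have h₀ : (ShortComplex.mk (0 : (0 : A) ⟶ 0) (0 : (0 : A) ⟶ 0) (by simp)).ShortExact :=
    { exact := ShortComplex.exact_of_isZero_X₂ _ (isZero_zero A)
      mono_f := (isZero_zero A).mono _
      epi_g := (isZero_zero A).epi _ }
  have h₁ : (ShortComplex.mk e.hom (0 : W ⟶ 0) (by simp)).ShortExact :=
    { exact := (ShortComplex.exact_iff_epi _ rfl).2 inferInstance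
      mono_f := inferInstance
      epi_g := (isZero_zero A).epi _ }
  have hd := σ.deg_add h₁
  have hr := σ.rank_add h₁
  have hd₀ := σ.deg_add h₀
  have hr₀ := σ.rank_add h₀
  dsimp only at hd hr hd₀ hr₀
  rw [slope, slope, hd, hr]
  congr 1 <;> linarith

variable (σ) in
/-- A nonzero object has a stable quotient of at most its slope, a proper one if the object is not
stable itself. -/
theorem exists_stable_quotient (V : A) (hV : ¬ IsZero V) :
    ∃ (B : A) (p : V ⟶ B), Epi p ∧ σ.IsStable B ∧ σ.slope B ≤ σ.slope V ∧
      (¬ σ.IsStable V → ¬ IsIso p) := by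
  induction hn : σ.len V using Nat.strong_induction_on generalizing V with
  | _ n ih =>
    by_cases hs : σ.IsStable V
    · exact ⟨V, 𝟙 V, inferInstance, hs, le_rfl, fun h => absurd hs h⟩
    · obtain ⟨U, f, _, hU, hf, hle⟩ : ∃ (U : A) (f : U ⟶ V), Mono f ∧ ¬ IsZero U ∧ ¬ IsIso f ∧
          σ.slope V ≤ σ.slope U := by
        simpa [IsStable, hV] using hs
      have hS := shortExact_of_mono f
      have hW := not_isZero_cokernel f hf
      have hlen := σ.len_add hS
      have hUlen := σ.len_pos hU
      dsimp only at hlen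
      obtain ⟨B, p, _, hB, hBle, -⟩ := ih (σ.len (cokernel f)) (by omega) _ hW rfl
      have hle' := not_lt.1 (mt (slope_left_lt_iff (σ := σ) hS hU hW).2 (not_lt.2 hle))
      refine ⟨B, cokernel.π f ≫ p, epi_comp _ _, hB, hBle.trans hle', fun _ _ => hU ?_⟩
      have : Mono (cokernel.π f) := mono_of_mono _ p
      exact IsZero.of_mono_eq_zero f (zero_of_comp_mono _ (cokernel.condition f))

/-- Jordan–Hölder induction: a property holds for all objects of which no subobject has a greater
slope if it holds for stable objects and passes to extensions by a stable quotient of the same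
slope. -/
theorem semistable_induction {P : A → Prop} {s : ℝ}
    (stable : ∀ B, σ.IsStable B → σ.slope B = s → P B)
    (ext : ∀ S : ShortComplex A, S.ShortExact → P S.X₁ → σ.IsStable S.X₃ → σ.slope S.X₃ = s →
      P S.X₂)
    (V : A) (hV : ¬ IsZero V) (hs : σ.slope V = s)
    (hss : ∀ (U : A) (f : U ⟶ V), Mono f → ¬ IsZero U → σ.slope U ≤ s) : P V := by
  induction hn : σ.len V using Nat.strong_induction_on generalizing V with
  | _ n ih =>
    by_cases hst : σ.IsStable V
    · exact stable V hst hs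
    · obtain ⟨B, p, _, hB, hle, hp⟩ := σ.exists_stable_quotient V hV
      have hS := shortExact_of_epi p
      have hK := not_isZero_kernel p (hp hst)
      have hlen := σ.len_add hS
      have hBlen := σ.len_pos hB.1
      dsimp only at hlen
      have h1 := hss _ (kernel.ι p) inferInstance hK
      have hB' : σ.slope B = s := by
        refine le_antisymm (hs ▸ hle) (not_lt.1 fun h => ?_)
        rw [← hs] at h h1
        exact absurd ((slope_middle_lt_iff (σ := σ) hS hK hB.1).2 h) (not_lt.2 h1)
      have hK' : σ.slope (kernel p) = s := by
        refine le_antisymm h1 (not_lt.1 fun h => ?_)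
        rw [← hs] at h
        have := (slope_left_lt_iff (σ := σ) hS hK hB.1).1 h
        dsimp only at this
        linarith
      refine ext _ hS (ih (σ.len (kernel p)) (by omega) _ hK hK' (fun U f _ hU => ?_) rfl) hB hB'
      exact hss U (f ≫ kernel.ι p) (mono_comp _ _) hU

end SlopeFunction

end Slope

/-! ### Stability in a triangulated category and in a heart -/

section Comparison

theorem strictMonoOn_neg_cos_div_sin :
    StrictMonoOn (fun x : ℝ => -Real.cos x / Real.sin x) (Set.Ioo 0 Real.pi) := by
  intro x hx y hy hxy
  have sx := Real.sin_pos_of_mem_Ioo hx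
  have sy := Real.sin_pos_of_mem_Ioo hy
  have h := Real.sin_pos_of_mem_Ioo (x := y - x) ⟨by linarith, by linarith [hx.1, hy.2]⟩
  rw [Real.sin_sub] at h
  dsimp only
  rw [div_lt_div_iff₀ sx sy]
  nlinarith

/-- The situation of the comparison between stability in a triangulated category and slope
stability in a heart `A`: a bounded t-structure with heart `A`, a `Π`-stability condition, stable
objects `L j` of the heart with grades in `(ψ, ψ + 1)` such that every nonzero object of the heart
contains some `L j`, and a slope function that describes the central charge, turned by the angle
`-πψ` into the upper half plane. -/
structure Comparison {T : Type*} [Category* T] [HasZeroObject T] [HasShift T ℤ] [Preadditive T]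
    [∀ n : ℤ, (shiftFunctor T n).Additive] [Pretriangulated T] (t : TStructure T)
    (A : Type*) [Category* A] [Abelian A] [t.Heart A] {Λ : Type*} [AddCommGroup Λ] {cl : T → Λ}
    (S : PiStability cl) {J : Type*} (L : J → A) (ψ : ℝ) (σ : SlopeFunction A) : Prop where
  exists_isGE (X : T) : ∃ a, t.IsGE X a
  exists_isLE (X : T) : ∃ b, t.IsLE X b
  exists_distTriang {E : ShortComplex A} : E.ShortExact →
    ∃ δ, Triangle.mk (t.ιHeart.map E.f) (t.ιHeart.map E.g) δ ∈ distTriang T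
  exists_mono (V : A) : ¬ IsZero V → ∃ (j : J) (f : L j ⟶ V), Mono f
  stable (j : J) : S.stable (t.ιHeart.obj (L j))
  lt_grade (j : J) : ψ < S.ξ (t.ιHeart.obj (L j))
  grade_lt (j : J) : S.ξ (t.ιHeart.obj (L j)) < ψ + 1
  charge (V : A) : S.Z (cl (t.ιHeart.obj V)) =
    Complex.exp (Real.pi * ψ * Complex.I) * ⟨-σ.deg V, σ.rank V⟩

namespace Comparison

variable {T : Type*} [Category* T] [HasZeroObject T] [HasShift T ℤ] [Preadditive T]
    [∀ n : ℤ, (shiftFunctor T n).Additive] [Pretriangulated T] {t : TStructure T}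
    {A : Type*} [Category* A] [Abelian A] [t.Heart A] {Λ : Type*} [AddCommGroup Λ] {cl : T → Λ}
    {S : PiStability cl} {J : Type*} {L : J → A} {ψ : ℝ} {σ : SlopeFunction A}
    (H : Comparison t A S L ψ σ)

include H

theorem not_isZero_simple (j : J) : ¬ IsZero (L j) := fun h =>
  S.not_isZero (H.stable j) (t.ιHeart.map_isZero h)

/-- As the `L j` generate the heart by extensions, an object that receives no nonzero map from
any of them receives none from the heart. -/
theorem hom_eq_zero_of_simple_left {X : T} (hX : ∀ (j : J) (f : t.ιHeart.obj (L j) ⟶ X), f = 0)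
    (V : A) (f : t.ιHeart.obj V ⟶ X) : f = 0 := by
  induction hn : σ.len V using Nat.strong_induction_on generalizing V with
  | _ n ih =>
    by_cases hV : IsZero V
    · exact (t.ιHeart.map_isZero hV).eq_of_src _ _
    · obtain ⟨j, i, _⟩ := H.exists_mono V hV
      have hE := shortExact_of_mono i
      have hlen := σ.len_add hE
      have hL := σ.len_pos (H.not_isZero_simple j)
      dsimp only at hlen
      obtain ⟨δ, hδ⟩ := H.exists_distTriang hE
      obtain ⟨l, hl⟩ := exists_desc_of_distTriang hδ f (hX j _)
      rw [hl, ih (σ.len (cokernel i)) (by omega) _ l rfl, comp_zero]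

/-- As the `L j` generate the heart by extensions, an object without nonzero maps to any of them
has none to the heart. -/
theorem hom_eq_zero_of_simple_right {X : T} (hX : ∀ (j : J) (f : X ⟶ t.ιHeart.obj (L j)), f = 0)
    (V : A) (f : X ⟶ t.ιHeart.obj V) : f = 0 := by
  induction hn : σ.len V using Nat.strong_induction_on generalizing V with
  | _ n ih =>
    by_cases hV : IsZero V
    · exact (t.ιHeart.map_isZero hV).eq_of_tgt _ _
    · obtain ⟨j, i, _⟩ := H.exists_mono V hV
      have hE := shortExact_of_mono i
      have hlen := σ.len_add hE
      have hL := σ.len_pos (H.not_isZero_simple j)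
      dsimp only at hlen
      obtain ⟨δ, hδ⟩ := H.exists_distTriang hE
      obtain ⟨l, hl⟩ := exists_lift_of_distTriang hδ f
        (ih (σ.len (cokernel i)) (by omega) _ _ rfl)
      rw [hl, hX j l, zero_comp]

/-- A stable object with a nonzero map from the heart has grade greater than `ψ`. -/
theorem lt_grade_of_hom_ne_zero {X : T} (hX : S.stable X) {V : A} {f : t.ιHeart.obj V ⟶ X}
    (hf : f ≠ 0) : ψ < S.ξ X := by
  by_contra! h
  exact hf (H.hom_eq_zero_of_simple_left (fun j => S.unitarity (H.stable j) hX
    (h.trans_lt (H.lt_grade j))) V f)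

/-- A stable object with a nonzero map to the heart has grade less than `ψ + 1`. -/
theorem grade_lt_of_hom_ne_zero {X : T} (hX : S.stable X) {V : A} {f : X ⟶ t.ιHeart.obj V}
    (hf : f ≠ 0) : S.ξ X < ψ + 1 := by
  by_contra! h
  exact hf (H.hom_eq_zero_of_simple_right (fun j => S.unitarity hX (H.stable j)
    ((H.grade_lt j).trans_le h)) V f)

/-- Every translate `X[-k]` with `k > 0` has grade at most `ψ`, so it receives no nonzero map from
the heart; this removes the negative degrees of `X` one by one. -/
theorem isGE_zero_of_stable [IsTriangulated T] {X : T} (hX : S.stable X) (hψ : S.ξ X ≤ ψ + 1) :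
    t.IsGE X 0 := by
  have key : ∀ n : ℕ, t.IsGE X (-n) → t.IsGE X 0 := by
    intro n
    induction n with
    | zero => intro h; simpa using h
    | succ n ih =>
      intro h
      have hk : (-(n + 1 : ℕ) : ℤ) = -(n + 1) := by push_cast; ring
      rw [hk] at h
      have := t.isGE_shift X (-(n + 1)) (-(n + 1)) 0
      have hst := S.stable_shift (-(n + 1)) hX
      have h1 : t.IsGE (X⟦(-(n + 1) : ℤ)⟧) 1 := by
        refine isGE_one_of_heart t A _ fun V f => ?_
        by_contra hf
        have := H.lt_grade_of_hom_ne_zero hst hf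
        rw [S.ξ_shift _ hX] at this
        push_cast at this
        have : (0 : ℝ) ≤ n := n.cast_nonneg
        linarith
      exact ih (t.isGE_of_shift X (-n) (-(n + 1)) 1)
  obtain ⟨a, ha⟩ := H.exists_isGE X
  exact key a.natAbs (t.isGE_of_ge X _ a)

/-- Every translate `X[k]` with `k > 0` has grade greater than `ψ + 1`, so it has no nonzero map to
the heart; this removes the positive degrees of `X` one by one. -/
theorem isLE_zero_of_stable [IsTriangulated T] {X : T} (hX : S.stable X) (hψ : ψ < S.ξ X) :
    t.IsLE X 0 := by
  have key : ∀ n : ℕ, t.IsLE X n → t.IsLE X 0 := by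
    intro n
    induction n with
    | zero => intro h; simpa using h
    | succ n ih =>
      intro h
      push_cast at h
      have := t.isLE_shift X (n + 1) (n + 1) 0
      have hst := S.stable_shift (n + 1) hX
      have h1 : t.IsLE (X⟦(n + 1 : ℤ)⟧) (-1) := by
        refine isLE_neg_one_of_heart t A _ fun V f => ?_
        by_contra hf
        have := H.grade_lt_of_hom_ne_zero hst hf
        rw [S.ξ_shift _ hX] at this
        push_cast at this
        have : (0 : ℝ) ≤ n := n.cast_nonneg
        linarith
      exact ih (t.isLE_of_shift X n (n + 1) (-1))
  obtain ⟨b, hb⟩ := H.exists_isLE X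
  exact key b.natAbs (t.isLE_of_le X b _)

/-- A stable object with grade in `(ψ, ψ + 1]` lies in the heart. -/
theorem exists_iso_of_stable [IsTriangulated T] {X : T} (hX : S.stable X) (h₁ : ψ < S.ξ X)
    (h₂ : S.ξ X ≤ ψ + 1) : ∃ V : A, Nonempty (X ≅ t.ιHeart.obj V) := by
  have := H.isGE_zero_of_stable hX h₂
  have := H.isLE_zero_of_stable hX h₁
  exact exists_iso_heart t X

/-- Every stable object is a translate of an object of the heart. -/
theorem exists_iso_shift_of_stable [IsTriangulated T] {X : T} (hX : S.stable X) :
    ∃ (V : A) (n : ℤ), Nonempty (X ≅ (t.ιHeart.obj V)⟦n⟧) := by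
  -- the translate that moves the grade into `(ψ, ψ + 1]`
  obtain ⟨n, ⟨hn₁, hn₂⟩, -⟩ := existsUnique_add_zsmul_mem_Ioc one_pos (S.ξ X) ψ
  rw [zsmul_one, ← S.ξ_shift n hX] at hn₁ hn₂
  obtain ⟨V, ⟨e⟩⟩ := H.exists_iso_of_stable (S.stable_shift n hX) hn₁ hn₂
  exact ⟨V, -n, ⟨(shiftEquiv T n).unitIso.app X ≪≫ (shiftFunctor T (-n)).mapIso e⟩⟩

theorem grade_mem_Ioo {V : A} (hV : S.stable (t.ιHeart.obj V)) :
    S.ξ (t.ιHeart.obj V) ∈ Set.Ioo ψ (ψ + 1) :=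
  ⟨H.lt_grade_of_hom_ne_zero hV (S.id_ne_zero hV), H.grade_lt_of_hom_ne_zero hV (S.id_ne_zero hV)⟩

/-- The slope of a stable object of the heart is minus the cotangent of the argument of its turned
charge. -/
theorem slope_eq {V : A} (hV : S.stable (t.ιHeart.obj V)) :
    σ.slope V = -Real.cos (Real.pi * (S.ξ (t.ιHeart.obj V) - ψ)) /
      Real.sin (Real.pi * (S.ξ (t.ιHeart.obj V) - ψ)) := by
  obtain ⟨m, hm, h⟩ := S.charge_eq hV
  set x := S.ξ (t.ιHeart.obj V)
  have h1 : (⟨-σ.deg V, σ.rank V⟩ : ℂ) =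
      m * Complex.exp ((Real.pi * (x - ψ) : ℝ) * Complex.I) := by
    have h0 := Complex.exp_ne_zero (Real.pi * ψ * Complex.I)
    apply mul_left_cancel₀ h0
    rw [← H.charge, h, mul_left_comm, ← Complex.exp_add]
    congr 2
    push_cast
    ring
  have hre := congrArg Complex.re h1
  have him := congrArg Complex.im h1
  rw [Complex.re_ofReal_mul, Complex.exp_ofReal_mul_I_re] at hre
  rw [Complex.im_ofReal_mul, Complex.exp_ofReal_mul_I_im] at him
  dsimp only at hre him
  rw [SlopeFunction.slope, him, ← neg_neg (σ.deg V), hre, ← mul_neg, mul_div_mul_left _ _ hm.ne']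

theorem slope_lt_iff {V W : A} (hV : S.stable (t.ιHeart.obj V))
    (hW : S.stable (t.ιHeart.obj W)) :
    σ.slope V < σ.slope W ↔ S.ξ (t.ιHeart.obj V) < S.ξ (t.ιHeart.obj W) := by
  have mem {U : A} (hU : S.stable (t.ιHeart.obj U)) :
      Real.pi * (S.ξ (t.ιHeart.obj U) - ψ) ∈ Set.Ioo 0 Real.pi := by
    obtain ⟨h₁, h₂⟩ := H.grade_mem_Ioo hU
    have := Real.pi_pos
    constructor <;> nlinarith
  rw [H.slope_eq hV, H.slope_eq hW]
  refine (strictMonoOn_neg_cos_div_sin.lt_iff_lt (mem hV) (mem hW)).trans ?_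
  rw [mul_lt_mul_iff_right₀ Real.pi_pos, sub_lt_sub_iff_right]

/-- The partial extensions of a decay chain with all grades in `(ψ, ψ + 1)` lie in the heart,
and their slopes are at least the slope of the last piece. -/
theorem exists_iso_partial [IsTriangulated T] {X : T} {n : ℕ} (c : DecayChain S.stable S.ξ X n)
    (h₁ : ∀ i, ψ < S.ξ (c.A i)) (h₂ : ∀ i, S.ξ (c.A i) < ψ + 1) {W : A}
    (eW : c.A (Fin.last n) ≅ t.ιHeart.obj W) (i : Fin (n + 1)) :
    ∃ V : A, Nonempty (c.C i ≅ t.ιHeart.obj V) ∧ ¬ IsZero V ∧ σ.slope W ≤ σ.slope V := by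
  have piece (j : Fin (n + 1)) :
      ∃ U : A, Nonempty (c.A j ≅ t.ιHeart.obj U) ∧ ¬ IsZero U ∧ σ.slope W ≤ σ.slope U := by
    have hj := c.stable_piece j
    have hW := c.stable_piece (Fin.last n)
    obtain ⟨U, ⟨e⟩⟩ := H.exists_iso_of_stable hj (h₁ j) (h₂ j).le
    refine ⟨U, ⟨e⟩, fun h => S.not_isZero hj ((t.ιHeart.map_isZero h).of_iso e),
      not_lt.1 fun h => ?_⟩
    rw [H.slope_lt_iff (S.stable_of_iso e hj) (S.stable_of_iso eW hW), ← S.ξ_eq_of_iso e hj,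
      ← S.ξ_eq_of_iso eW hW] at h
    exact absurd (c.grade_antitone j.le_last) (not_le.2 h)
  induction i using Fin.induction with
  | zero =>
    obtain ⟨U, ⟨e⟩, hU⟩ := piece 0
    exact ⟨U, ⟨c.init ≪≫ e⟩, hU⟩
  | succ i ih =>
    obtain ⟨U, ⟨e⟩, hU, hle⟩ := ih
    obtain ⟨U', ⟨e'⟩, hU', hle'⟩ := piece i.succ
    obtain ⟨V, a, b, w, hE, eV⟩ := exists_shortExact_of_distTriang t (c.distinguished i) e e'
    have := hE.mono_f
    exact ⟨V, eV, fun h => hU (IsZero.of_mono a h),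
      SlopeFunction.le_slope_middle hE hU hU' hle hle'⟩

/-- In a decay chain of `V` with more than one piece, the first piece maps nontrivially to `V` and
`V` to the last one. So all grades lie in `(ψ, ψ + 1)`, and the last triangle is a short exact
sequence whose subobject has at least the slope of the quotient. -/
theorem stable_of_slope_stable [IsTriangulated T] {V : A} (hV : σ.IsStable V) :
    S.stable (t.ιHeart.obj V) := by
  by_contra hst
  have hne : ¬ IsZero (t.ιHeart.obj V) := fun h =>
    hV.1 (IsZero.of_full_of_faithful_of_isZero t.ιHeart V h)
  obtain ⟨n, ⟨c⟩⟩ := S.exists_decayChain hne hst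
  cases n with
  | zero => exact hst (S.stable_of_iso (c.init.symm ≪≫ c.last) (c.stable_piece 0))
  | succ n =>
    obtain ⟨f, hf⟩ := S.exists_first_ne_zero c
    obtain ⟨g, hg⟩ := S.exists_last_ne_zero c
    have h₁ (i) : ψ < S.ξ (c.A i) :=
      (H.lt_grade_of_hom_ne_zero (c.stable_piece _) hg).trans_le (c.grade_antitone i.le_last)
    have h₂ (i) : S.ξ (c.A i) < ψ + 1 :=
      (c.grade_antitone (Fin.zero_le i)).trans_lt (H.grade_lt_of_hom_ne_zero (c.stable_piece _) hf)
    obtain ⟨W, ⟨eW⟩⟩ := H.exists_iso_of_stable (c.stable_piece (Fin.last _)) (h₁ _) (h₂ _).le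
    obtain ⟨U, ⟨eU⟩, hU, hle⟩ := H.exists_iso_partial c h₁ h₂ eW (Fin.last n).castSucc
    obtain ⟨V', a, b, w, hE, ⟨eV⟩⟩ :=
      exists_shortExact_of_distTriang t (c.distinguished (Fin.last n)) eU eW
    have hW : ¬ IsZero W := fun h =>
      S.not_isZero (c.stable_piece (Fin.last _)) ((t.ιHeart.map_isZero h).of_iso eW)
    let e : V' ≅ V := t.ιHeart.preimageIso (eV.symm ≪≫ c.last)
    have := hE.mono_f
    have hUV := hV.2 U (a ≫ e.hom) (mono_comp _ _) hU fun h =>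
      hW (hE.isIso_f_iff.1 (IsIso.of_isIso_comp_right a e.hom))
    rw [← SlopeFunction.slope_eq_of_iso e] at hUV
    have := (SlopeFunction.slope_left_lt_iff (σ := σ) hE hU hW).1 hUV
    dsimp only at this
    linarith

/-- No subobject of a stable object of the heart has a greater slope: otherwise a stable quotient
of the cokernel would receive a nonzero map although its grade is too small. -/
theorem slope_le_of_stable [IsTriangulated T] {V : A} (hV : S.stable (t.ιHeart.obj V)) {U : A}
    (f : U ⟶ V) [Mono f] (hU : ¬ IsZero U) : σ.slope U ≤ σ.slope V := by
  by_contra! h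
  by_cases hf : IsIso f
  · exact h.ne' (SlopeFunction.slope_eq_of_iso (asIso f))
  · have hC := not_isZero_cokernel f hf
    have hlt := (SlopeFunction.slope_middle_lt_iff (σ := σ) (shortExact_of_mono f) hU hC).1 h
    obtain ⟨B, p, _, hB, hle, -⟩ := σ.exists_stable_quotient _ hC
    have hB' := H.stable_of_slope_stable hB
    have h0 := S.unitarity hV hB' ((H.slope_lt_iff hB' hV).1 (hle.trans_lt hlt))
      (t.ιHeart.map (cokernel.π f ≫ p))
    have : Epi (cokernel.π f ≫ p) := epi_comp _ _
    exact hB.1 (IsZero.of_epi_eq_zero _ (t.ιHeart.map_injective (h0.trans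
      (t.ιHeart.map_zero _ _).symm)))

/-- A stable object `V` of the heart is semistable, so extensions by slope stable objects of the
same slope build a decay chain of `V`. It has one piece only, which means that `V` is slope
stable. -/
theorem slope_stable_of_stable [IsTriangulated T] {V : A} (hV : S.stable (t.ιHeart.obj V)) :
    σ.IsStable V := by
  have hne : ¬ IsZero V := fun h => S.not_isZero hV (t.ιHeart.map_isZero h)
  have grade {B : A} (hB : σ.IsStable B) (hs : σ.slope B = σ.slope V) :
      S.ξ (t.ιHeart.obj B) = S.ξ (t.ιHeart.obj V) := by
    have hB' := H.stable_of_slope_stable hB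
    refine le_antisymm (not_lt.1 fun h => ?_) (not_lt.1 fun h => ?_)
    · exact ((H.slope_lt_iff hV hB').2 h).ne' hs
    · exact ((H.slope_lt_iff hB' hV).2 h).ne hs
  -- the property records that the chain has more than one piece unless the object is slope stable
  obtain ⟨n, c, -, hn | h⟩ := SlopeFunction.semistable_induction (σ := σ) (s := σ.slope V)
    (P := fun X => ∃ (n : ℕ) (c : DecayChain S.stable S.ξ (t.ιHeart.obj X) n),
      (∀ i, S.ξ (c.A i) = S.ξ (t.ιHeart.obj V)) ∧ (0 < n ∨ σ.IsStable X))
    (fun B hB hs => ⟨0, DecayChain.single S.ξ (H.stable_of_slope_stable hB),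
      fun _ => grade hB hs, Or.inr hB⟩)
    (fun E hE hP hB hs => by
      obtain ⟨n, c, hc, -⟩ := hP
      obtain ⟨δ, hδ⟩ := H.exists_distTriang hE
      obtain ⟨c', hc'⟩ := c.exists_snoc hδ (H.stable_of_slope_stable hB)
        ((grade hB hs).trans (hc _).symm).le
      refine ⟨n + 1, c', fun i => ?_, Or.inl n.succ_pos⟩
      rw [hc']
      induction i using Fin.lastCases with
      | last => rw [Fin.snoc_last]; exact grade hB hs
      | cast i => rw [Fin.snoc_castSucc]; exact hc i)
    V hne rfl (fun U f _ hU => H.slope_le_of_stable hV f hU)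
  · exact ((S.no_decayChain hV n hn).false c).elim
  · exact h

end Comparison
end Comparison

/-! ### The bounded derived category of representations -/

section Quiver

variable {Q : Type u} [Quiver.{v} Q] {R : Relations Q}

theorem dimVec_eq_of_iso {V W : QRep R} (e : V ≅ W) : dimVec V = dimVec W := by
  funext j
  rw [dimVec_eq_finrank, dimVec_eq_finrank,
    LinearEquiv.finrank_eq ((nodeFunctor R j).mapIso e).toLinearEquiv]

section

variable [HasDerivedCategory.{w} (QRep R)]

variable (R) in
/-- The inclusion of the representations into `D(Q)` as stalk complexes in position zero. -/
def stalkFunctor : QRep R ⥤ DQ R :=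
  ObjectProperty.lift _ (DerivedCategory.singleFunctor (QRep R) 0) fun V => (stalk V).property

instance : (stalkFunctor R).Full :=
  Functor.Full.of_comp_faithful_iso (ObjectProperty.liftCompιIso _
    (DerivedCategory.singleFunctor (QRep R) 0) fun V => (stalk V).property)

instance : (stalkFunctor R).Faithful :=
  Functor.Faithful.of_comp_iso (ObjectProperty.liftCompιIso _
    (DerivedCategory.singleFunctor (QRep R) 0) fun V => (stalk V).property)

instance : (stalkFunctor R).Additive where
  map_add := ObjectProperty.hom_ext _ (DerivedCategory.singleFunctor (QRep R) 0).map_add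

variable (R) in
/-- The standard t-structure on `D(Q)`. -/
abbrev standardT : TStructure (DQ R) := (DerivedCategory.TStructure.t (C := QRep R)).onBounded

/-- The heart of the standard t-structure is the category of representations, included as stalk
complexes. -/
instance : (standardT R).Heart (QRep R) where
  ι := stalkFunctor R
  essImage_eq_heart := by
    ext X
    rw [TStructure.mem_heart_iff, ObjectProperty.tStructure_isLE_iff,
      ObjectProperty.tStructure_isGE_iff]
    constructor
    · rintro ⟨V, ⟨e⟩⟩
      let e' := (DerivedCategory.TStructure.t (C := QRep R)).bounded.ι.mapIso e
      let e'' : (DerivedCategory.singleFunctor (QRep R) 0).obj V ≅ X.obj := e'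
      exact ⟨TStructure.isLE_of_iso _ e'' 0, TStructure.isGE_of_iso _ e'' 0⟩
    · rintro ⟨_, _⟩
      obtain ⟨V, ⟨e⟩⟩ :=
        DerivedCategory.exists_iso_singleFunctor_obj_of_isGE_of_isLE X.obj 0
      exact ⟨V, ⟨ObjectProperty.isoMk _ e.symm⟩⟩

theorem exists_distTriang_stalk {E : ShortComplex (QRep R)} (hE : E.ShortExact) :
    ∃ δ, Triangle.mk ((stalkFunctor R).map E.f) ((stalkFunctor R).map E.g) δ ∈
      distTriang (DQ R) := by
  let P := (DerivedCategory.TStructure.t (C := QRep R)).bounded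
  let δ : stalk E.X₃ ⟶ (stalk E.X₁)⟦(1 : ℤ)⟧ := P.fullyFaithfulι.preimage
    (hE.singleδ ≫ (P.ι.commShiftIso (1 : ℤ)).inv.app (stalk E.X₁))
  refine ⟨δ, ?_⟩
  refine isomorphic_distinguished _ hE.singleTriangle_distinguished _
    (Triangle.isoMk _ _ (Iso.refl _) (Iso.refl _) (Iso.refl _) ?_ ?_ ?_)
  · exact (Category.comp_id _).trans (Category.id_comp _).symm
  · exact (Category.comp_id _).trans (Category.id_comp _).symm
  · refine (congrArg (_ ≫ ·) (CategoryTheory.Functor.map_id _ _)).trans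
      ((Category.comp_id _).trans (Eq.trans ?_ (Category.id_comp _).symm))
    exact (Category.assoc _ _ _).trans
      ((congrArg (hE.singleδ ≫ ·) ((P.ι.commShiftIso (1 : ℤ)).inv_hom_id_app (stalk E.X₁))).trans
          (Category.comp_id _))

theorem classVec_stalk (V : QRep R) : classVec (stalk V) = dimVec V := by
  funext j
  rw [classVec, finsum_eq_single _ 0]
  · rw [Int.negOnePow_zero, Units.val_one, one_mul]
    exact congr_fun (dimVec_eq_of_iso
      ((DerivedCategory.singleFunctorCompHomologyFunctorIso (QRep R) 0).app V)) j
  · intro i hi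
    have h : IsZero ((DerivedCategory.homologyFunctor (QRep R) i).obj (stalk V).obj) := by
      change IsZero ((DerivedCategory.homologyFunctor (QRep R) i).obj
        ((DerivedCategory.singleFunctor (QRep R) 0).obj V))
      rcases lt_or_gt_of_ne hi with h | h
      · exact DerivedCategory.isZero_of_isGE _ 0 i h
      · exact DerivedCategory.isZero_of_isLE _ 0 i h
    rw [(isZero_iff_dimVec_eq_zero _).1 h, Pi.zero_apply, mul_zero]

end

/-- A point on the ray of argument `πx` with `ψ < x < ψ + 1`, turned by the angle `-πψ`, lies in
the open upper half plane. -/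
theorem im_turn_pos {ψ x m : ℝ} (h₁ : ψ < x) (h₂ : x < ψ + 1) (hm : 0 < m) :
    0 < (Complex.exp (-(Real.pi * ψ * Complex.I)) *
      (m * Complex.exp (Real.pi * x * Complex.I))).im := by
  rw [mul_left_comm, ← Complex.exp_add, Complex.im_ofReal_mul]
  have : -(Real.pi * ψ * Complex.I) + Real.pi * x * Complex.I =
      ((Real.pi * (x - ψ) : ℝ) : ℂ) * Complex.I := by
    push_cast
    ring
  rw [this, Complex.exp_ofReal_mul_I_im]
  have := Real.pi_pos
  exact mul_pos hm (Real.sin_pos_of_mem_Ioo ⟨by nlinarith, by nlinarith⟩)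

theorem exists_dimVec_pos {V : QRep R} (hV : ¬ IsZero V) : ∃ j, 0 < dimVec V j := by
  obtain ⟨j, hj⟩ := Function.ne_iff.1 (mt (isZero_iff_dimVec_eq_zero V).2 hV)
  exact ⟨j, (dimVec_nonneg V j).lt_of_ne' hj⟩

variable [Fintype Q]

/-- If the charges `Z(L_j)`, turned by the angle `-πψ`, lie in the open upper half plane, then so
do the charges of all nonzero representations. -/
theorem im_turn_charge_pos {Z : (Q → ℤ) →+ ℂ} {z : ℂ}
    (hZ : ∀ j, 0 < (z * Z (dimVec (simpleRep R j))).im) {V : QRep R} (hV : ¬ IsZero V) :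
    0 < (z * Z (dimVec V)).im := by
  obtain ⟨j, hj⟩ := exists_dimVec_pos hV
  have h : (z * Z (dimVec V)).im =
      ∑ j, (dimVec V j : ℝ) * (z * Z (dimVec (simpleRep R j))).im := by
    have h' := congrArg (z * Z ·) (dimVec_eq_sum_simpleRep V)
    rw [h', map_sum, Finset.mul_sum, Complex.im_sum]
    refine Finset.sum_congr rfl fun j _ => ?_
    rw [map_zsmul, zsmul_eq_mul, mul_left_comm, ← Complex.ofReal_intCast,
      Complex.im_ofReal_mul]
  rw [h]
  refine Finset.sum_pos' (fun i _ => mul_nonneg ?_ (hZ i).le)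
    ⟨j, Finset.mem_univ j, mul_pos ?_ (hZ j)⟩
  · exact_mod_cast dimVec_nonneg V i
  · exact_mod_cast hj

/-- The slope function of a central charge that, multiplied by `z`, sends the nonzero
representations to the upper half plane: the slope is minus the cotangent of the argument. -/
def chargeSlope (Z : (Q → ℤ) →+ ℂ) (z : ℂ)
    (hZ : ∀ j, 0 < (z * Z (dimVec (simpleRep R j))).im) : SlopeFunction (QRep R) where
  deg V := -(z * Z (dimVec V)).re
  rank V := (z * Z (dimVec V)).im
  len V := ∑ j, (dimVec V j).toNat
  deg_add hS := by
    rw [dimVec_shortExact hS, map_add, mul_add, Complex.add_re, neg_add]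
  rank_add hS := by
    rw [dimVec_shortExact hS, map_add, mul_add, Complex.add_im]
  len_add hS := by
    rw [dimVec_shortExact hS, ← Finset.sum_add_distrib]
    exact Finset.sum_congr rfl fun j _ => Int.toNat_add (dimVec_nonneg _ j) (dimVec_nonneg _ j)
  rank_pos hV := im_turn_charge_pos hZ hV
  len_pos hV := by
    obtain ⟨j, hj⟩ := exists_dimVec_pos hV
    exact Finset.sum_pos' (fun _ _ => Nat.zero_le _) ⟨j, Finset.mem_univ j, by omega⟩

/-- Multiplying both charges by `z` does not change their quotient, and for points of the upper half
plane the sign of the imaginary part of the quotient compares the cotangents. -/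
theorem theta_pos_iff {Z : (Q → ℤ) →+ ℂ} {z : ℂ}
    (hZ : ∀ j, 0 < (z * Z (dimVec (simpleRep R j))).im) {U V : QRep R} (hU : ¬ IsZero U)
    (hV : ¬ IsZero V) : 0 < theta Z V (dimVec U) ↔
      (chargeSlope Z z hZ).slope U < (chargeSlope Z z hZ).slope V := by
  have pU := im_turn_charge_pos hZ hU
  have pV := im_turn_charge_pos hZ hV
  have hz : z ≠ 0 := by
    rintro rfl
    simp at pU
  change 0 < -(Z (dimVec U) / Z (dimVec V)).im ↔
    -(z * Z (dimVec U)).re / (z * Z (dimVec U)).im < -(z * Z (dimVec V)).re / (z * Z (dimVec V)).im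
  rw [← mul_div_mul_left _ _ hz]
  generalize z * Z (dimVec U) = a at *
  generalize z * Z (dimVec V) = b at *
  have hb : 0 < Complex.normSq b := Complex.normSq_pos.2 (by rintro rfl; simp at pV)
  rw [div_lt_div_iff₀ pU pV, Complex.div_im, ← sub_div, neg_pos, div_lt_iff₀ hb, zero_mul]
  constructor <;> intro h <;> linarith

theorem isThetaStable_iff {Z : (Q → ℤ) →+ ℂ} {z : ℂ}
    (hZ : ∀ j, 0 < (z * Z (dimVec (simpleRep R j))).im) (V : QRep R) :
    IsThetaStable (theta Z V) V ↔ (chargeSlope Z z hZ).IsStable V := by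
  have h0 : theta Z V (dimVec V) = 0 := by
    change -(Z (dimVec V) / Z (dimVec V)).im = 0
    by_cases h : Z (dimVec V) = 0
    · simp [h]
    · simp [div_self h]
  constructor
  · rintro ⟨hV, -, h⟩
    exact ⟨hV, fun U f hf hU hi => (theta_pos_iff hZ hU hV).1 (h U f hf hU hi)⟩
  · rintro ⟨hV, h⟩
    exact ⟨hV, h0, fun U f hf hU hi => (theta_pos_iff hZ hU hV).2 (h U f hf hU hi)⟩

/-- The hypotheses on the grades of the `L_j` put `D(Q)`, with its standard t-structure, into the
situation of `Comparison`. -/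
theorem comparison_quiver (hQ : Directed Q) [HasDerivedCategory.{w} (QRep R)]
    (S : PiStability (classVec (R := R))) (hL : ∀ j : Q, S.stable (stalk (simpleRep R j)))
    {ψ : ℝ} (hψ : ∀ j : Q, ψ < S.ξ (stalk (simpleRep R j)) ∧ S.ξ (stalk (simpleRep R j)) < ψ + 1)
    (hZ : ∀ j, 0 < (Complex.exp (-(Real.pi * ψ * Complex.I)) *
      S.Z (dimVec (simpleRep R j))).im) :
    Comparison (standardT R) (QRep R) S (simpleRep R) ψ
      (chargeSlope S.Z (Complex.exp (-(Real.pi * ψ * Complex.I))) hZ) where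
  exists_isGE X := X.property.1.imp fun a h => (ObjectProperty.tStructure_isGE_iff _ _ X a).2 h
  exists_isLE X := X.property.2.imp fun a h => (ObjectProperty.tStructure_isLE_iff _ _ X a).2 h
  exists_distTriang hE := exists_distTriang_stalk hE
  exists_mono V hV := exists_mono_simpleRep hQ V hV
  stable := hL
  lt_grade j := (hψ j).1
  grade_lt j := (hψ j).2
  charge V := by
    refine (congrArg S.Z (classVec_stalk V)).trans ?_
    have h : (⟨- -(Complex.exp (-(Real.pi * ψ * Complex.I)) * S.Z (dimVec V)).re,
        (Complex.exp (-(Real.pi * ψ * Complex.I)) * S.Z (dimVec V)).im⟩ : ℂ) =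
        Complex.exp (-(Real.pi * ψ * Complex.I)) * S.Z (dimVec V) :=
      Complex.ext (neg_neg _) rfl
    exact ((congrArg _ h).trans (by
      rw [← mul_assoc, ← Complex.exp_add, add_neg_cancel, Complex.exp_zero, one_mul])).symm

end Quiver
end PiTheta

end

theorem mainTheorem1 {Q : Type u} [Quiver.{v} Q] [Fintype Q] (hQ : PiTheta.Directed Q)
    (R : PiTheta.Relations Q) [HasDerivedCategory.{w} (PiTheta.QRep R)]
    (S : PiTheta.PiStability (PiTheta.classVec (R := R)))
    (hL : ∀ j : Q, S.stable (PiTheta.stalk (PiTheta.simpleRep R j)))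
    (ψ : ℝ)
    (hψ : ∀ j : Q, ψ < S.ξ (PiTheta.stalk (PiTheta.simpleRep R j)) ∧
      S.ξ (PiTheta.stalk (PiTheta.simpleRep R j)) < ψ + 1) :
    (∀ X : PiTheta.DQ R, S.stable X →
      ∃ (V : PiTheta.QRep R) (n : ℤ), Nonempty (X ≅ (PiTheta.stalk V)⟦n⟧)) ∧
    (∀ V : PiTheta.QRep R, ¬ IsZero V → S.Z (PiTheta.dimVec V) ≠ 0) ∧
    (∀ (V : PiTheta.QRep R) (n : ℤ),
      S.stable ((PiTheta.stalk V)⟦n⟧) ↔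
        PiTheta.IsThetaStable (PiTheta.theta S.Z V) V) := by
  have hZ (j : Q) : 0 < (Complex.exp (-(Real.pi * ψ * Complex.I)) *
      S.Z (PiTheta.dimVec (PiTheta.simpleRep R j))).im := by
    obtain ⟨m, hm, h⟩ := S.charge_eq (hL j)
    rw [← PiTheta.classVec_stalk, h]
    exact PiTheta.im_turn_pos (hψ j).1 (hψ j).2 hm
  have H := PiTheta.comparison_quiver hQ S hL hψ hZ
  refine ⟨fun X hX => H.exists_iso_shift_of_stable hX, fun V hV h => ?_, fun V n => ?_⟩
  · have := PiTheta.im_turn_charge_pos hZ hV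
    simp [h] at this
  · rw [PiTheta.isThetaStable_iff hZ]
    constructor
    · intro h
      refine H.slope_stable_of_stable (S.stable_of_iso ?_ (S.stable_shift (-n) h))
      exact ((shiftEquiv (PiTheta.DQ R) n).unitIso.app (PiTheta.stalk V)).symm
    · exact fun h => S.stable_shift n (H.stable_of_slope_stable h)
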